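/- Let $\Gamma$ be a finite simple graph with vertex set $S$, and let $$W=\langle S \mid s^2 \ (s\in S),\ (st)^2 \ (s,t \text{ adjacent in } \Gamma)\rangle$$ be the right angled Coxeter group determined by $\Gamma$. A subset $J\subseteq S$ (possibly empty) is called spherical if the subgroup $W_J=\langle J\rangle\le W$ is finite; the subgroups $W_J$ with $J$ spherical are the spherical subgroups of $W$. Let $\Sigma$ be the Davis complex of $W$, i.e. the geometric realization of the poset of all cosets $wW_J$ ($w\in W$, $J\subseteq S$ spherical), ordered by inclusion, with $W$ acting by left multiplication; its $n$-cells are the chains $w_0W_{J_0}\subsetneq\dots\subsetneq w_nW_{J_n}$. Let $\mathcal{O}_{\mathcal F}W$ be the orbit category of $W$ with respect to the family $\mathcal F$ of finite subgroups (objects: the $W$-sets $W/H$ with $H\in\mathcal F$; morphisms: all $W$-equivariant maps), and let $R(-)\colon \mathcal{O}_{\mathcal F}W\to \mathrm{Ab}$ be the contravariant functor sending $W/H$ to the complex representation ring $R(H)$ (the Grothendieck group of the monoid of isomorphism classes of finite dimensional complex representations of $H$) and sending the $W$-map $W/H\to W/K$, $H\mapsto aK$, to restriction along $H\to K$, $h\mapsto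 a^{-1}ha$. Let $\mathrm{H}^n_W(\Sigma,R(-))$ denote Bredon cohomology, the $n$-th cohomology of the cochain complex $\mathrm{Hom}_{\mathcal{O}_{\mathcal F}W}(C_*(\Sigma^{-}),R(-))$ of natural transformations, where $C_*(\Sigma^{H})$ is the cellular chain complex of the fixed point set $\Sigma^H$. Then $\mathrm{H}^n_W(\Sigma,R(-))=0$ for all $n>0$, and $\mathrm{H}^0_W(\Sigma,R(-))$ is a free abelian group of rank equal to the number of spherical subgroups of $W$. -/

import Mathlib

open CategoryTheory

universe u

noncomputable section

/-! ### The complex representation ring of a group, as an abelian group -/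

namespace RepRing

variable {H K L : Type u} [Group H] [Group K] [Group L]

/-- Finite dimensional complex representations of `H`, on the model spaces `ℂⁿ`. -/
def FinRep (H : Type u) [Group H] : Type u :=
  Σ n : ℕ, Representation ℂ H (Fin n → ℂ)

/-- Isomorphism of representations. -/
instance finRepSetoid (H : Type u) [Group H] : Setoid (FinRep H) where
  r ρ σ := Nonempty (ρ.2.Equiv σ.2)
  iseqv :=
    { refl := fun ρ => ⟨Representation.Equiv.refl ρ.2⟩
      symm := fun ⟨e⟩ => ⟨e.symm⟩
      trans := fun ⟨e⟩ ⟨f⟩ => ⟨e.trans f⟩ }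

/-- Isomorphism classes of finite dimensional complex representations of `H`. -/
def RepClass (H : Type u) [Group H] : Type u := Quotient (finRepSetoid H)

/-- A finite dimensional representation transported to the model space by a choice of basis. -/
def model {V : Type*} [AddCommGroup V] [Module ℂ V] [FiniteDimensional ℂ V]
    (ρ : Representation ℂ H V) : FinRep H :=
  ⟨Module.finrank ℂ V,
    { toFun := fun h => (Module.finBasis ℂ V).equivFun.conj (ρ h)
      map_one' := by simp [Module.End.one_eq_id]
      map_mul' := fun g h => by
        rw [map_mul, Module.End.mul_eq_comp, LinearEquiv.conj_comp]; rfl }⟩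

/-- The model of a representation is isomorphic to it. -/
def modelEquiv {V : Type*} [AddCommGroup V] [Module ℂ V] [FiniteDimensional ℂ V]
    (ρ : Representation ℂ H V) : ρ.Equiv (model ρ).2 :=
  Representation.Equiv.mk (Module.finBasis ℂ V).equivFun fun h => by
    ext v i
    change _ = (Module.finBasis ℂ V).equivFun.conj (ρ h) ((Module.finBasis ℂ V).equivFun v) i
    rw [LinearEquiv.conj_apply]
    simp
    rfl

/-- The isomorphism class of an arbitrary finite dimensional complex representation. -/
def cls {V : Type*} [AddCommGroup V] [Module ℂ V] [FiniteDimensional ℂ V]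
    (ρ : Representation ℂ H V) : RepClass H := Quotient.mk _ (model ρ)

theorem cls_eq_iff {V V' : Type*} [AddCommGroup V] [Module ℂ V] [FiniteDimensional ℂ V]
    [AddCommGroup V'] [Module ℂ V'] [FiniteDimensional ℂ V']
    (ρ : Representation ℂ H V) (σ : Representation ℂ H V') :
    cls ρ = cls σ ↔ Nonempty (ρ.Equiv σ) := by
  refine Quotient.eq.trans ⟨fun ⟨e⟩ => ?_, fun ⟨e⟩ => ?_⟩
  · exact ⟨((modelEquiv ρ).trans e).trans (modelEquiv σ).symm⟩
  · exact ⟨((modelEquiv ρ).symm.trans e).trans (modelEquiv σ)⟩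

theorem mk_eq_cls (ρ : FinRep H) : (Quotient.mk _ ρ : RepClass H) = cls ρ.2 :=
  Quotient.sound ⟨modelEquiv ρ.2⟩

theorem ind_cls {p : RepClass H → Prop}
    (h : ∀ (n : ℕ) (ρ : Representation ℂ H (Fin n → ℂ)), p (cls ρ)) (x : RepClass H) : p x := by
  induction x using Quotient.ind with
  | _ ρ => rw [mk_eq_cls]; exact h _ _

/-- Direct sums of isomorphic representations are isomorphic. -/
def prodEquiv {V V' U U' : Type*} [AddCommGroup V] [Module ℂ V] [AddCommGroup V'] [Module ℂ V']
    [AddCommGroup U] [Module ℂ U] [AddCommGroup U'] [Module ℂ U']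
    {ρ : Representation ℂ H V} {ρ' : Representation ℂ H V'}
    {σ : Representation ℂ H U} {σ' : Representation ℂ H U'}
    (e : ρ.Equiv ρ') (f : σ.Equiv σ') : (ρ.prod σ).Equiv (ρ'.prod σ') :=
  Representation.Equiv.mk (e.toLinearEquiv.prodCongr f.toLinearEquiv) fun h => by
    apply LinearMap.ext
    rintro ⟨v, w⟩
    exact Prod.ext (LinearMap.congr_fun (e.toIntertwiningMap.isIntertwining' h) v)
      (LinearMap.congr_fun (f.toIntertwiningMap.isIntertwining' h) w)

/-- Addition of isomorphism classes is the direct sum of representations. -/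
instance (H : Type u) [Group H] : Add (RepClass H) where
  add := Quotient.lift₂ (fun ρ σ => cls (ρ.2.prod σ.2)) fun _ _ _ _ ⟨e⟩ ⟨f⟩ =>
    (cls_eq_iff _ _).2 ⟨prodEquiv e f⟩

/-- The class of the zero representation. -/
instance (H : Type u) [Group H] : Zero (RepClass H) where
  zero := cls (1 : Representation ℂ H (Fin 0 → ℂ))

theorem cls_add {V V' : Type*} [AddCommGroup V] [Module ℂ V] [FiniteDimensional ℂ V]
    [AddCommGroup V'] [Module ℂ V'] [FiniteDimensional ℂ V']
    (ρ : Representation ℂ H V) (σ : Representation ℂ H V') :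
    cls ρ + cls σ = cls (ρ.prod σ) :=
  (cls_eq_iff _ _).2 ⟨prodEquiv (modelEquiv ρ).symm (modelEquiv σ).symm⟩

instance (H : Type u) [Group H] : AddCommMonoid (RepClass H) where
  add_assoc x y z := by
    induction x using ind_cls with | _ n ρ
    induction y using ind_cls with | _ m σ
    induction z using ind_cls with | _ k τ
    simp only [cls_add]
    exact (cls_eq_iff _ _).2 ⟨Representation.Equiv.mk (LinearEquiv.prodAssoc ℂ _ _ _)
      fun h => by apply LinearMap.ext; rintro ⟨⟨a, b⟩, c⟩; rfl⟩
  zero_add x := by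
    induction x using ind_cls with | _ n ρ
    refine (cls_add _ _).trans ((cls_eq_iff _ _).2 ⟨Representation.Equiv.mk
      (LinearEquiv.uniqueProd (R := ℂ) (M₂ := Fin 0 → ℂ)) fun h => ?_⟩)
    apply LinearMap.ext; rintro ⟨a, b⟩; rfl
  add_zero x := by
    induction x using ind_cls with | _ n ρ
    refine (cls_add _ _).trans ((cls_eq_iff _ _).2 ⟨Representation.Equiv.mk
      (LinearEquiv.prodUnique (R := ℂ) (M₂ := Fin 0 → ℂ)) fun h => ?_⟩)
    apply LinearMap.ext; rintro ⟨a, b⟩; rfl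
  add_comm x y := by
    induction x using ind_cls with | _ n ρ
    induction y using ind_cls with | _ m σ
    simp only [cls_add]
    exact (cls_eq_iff _ _).2 ⟨Representation.Equiv.mk (LinearEquiv.prodComm ℂ _ _)
      fun h => by apply LinearMap.ext; rintro ⟨a, b⟩; rfl⟩
  nsmul := nsmulRec

/-- Restriction of isomorphism classes of representations along a homomorphism. -/
def resClass (φ : H →* K) : RepClass K →+ RepClass H where
  toFun := Quotient.lift (fun ρ => cls (MonoidHom.comp ρ.2 φ : Representation ℂ H _))
    fun _ _ ⟨e⟩ => (cls_eq_iff _ _).2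
      ⟨Representation.Equiv.mk e.toLinearEquiv fun h => e.toIntertwiningMap.isIntertwining' (φ h)⟩
  map_zero' := by
    refine (cls_eq_iff _ _).2 ⟨Representation.Equiv.mk (modelEquiv
      (1 : Representation ℂ K (Fin 0 → ℂ))).symm.toLinearEquiv fun h => ?_⟩
    exact (modelEquiv (1 : Representation ℂ K (Fin 0 → ℂ))).symm.toIntertwiningMap.isIntertwining'
      (φ h)
  map_add' x y := by
    induction x using Quotient.ind with | _ ρ
    induction y using Quotient.ind with | _ σ
    refine Eq.trans ?_ (cls_add _ _).symm
    refine (cls_eq_iff _ _).2 ⟨Representation.Equiv.mk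
      (modelEquiv (ρ.2.prod σ.2)).symm.toLinearEquiv fun h => ?_⟩
    exact (modelEquiv (ρ.2.prod σ.2)).symm.toIntertwiningMap.isIntertwining' (φ h)

theorem resClass_cls (φ : H →* K) {V : Type*} [AddCommGroup V] [Module ℂ V]
    [FiniteDimensional ℂ V] (ρ : Representation ℂ K V) :
    resClass φ (cls ρ) = cls (MonoidHom.comp ρ φ : Representation ℂ H V) :=
  (cls_eq_iff _ _).2 ⟨Representation.Equiv.mk (modelEquiv ρ).symm.toLinearEquiv fun h =>
    (modelEquiv ρ).symm.toIntertwiningMap.isIntertwining' (φ h)⟩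

/-- Restriction only depends on the homomorphism up to inner automorphisms of the target. -/
theorem resClass_conj (φ ψ : H →* K) (k : K) (h : ∀ x, ψ x = k⁻¹ * φ x * k) :
    resClass ψ = resClass φ := by
  ext x
  induction x using ind_cls with | _ n ρ
  rw [resClass_cls, resClass_cls]
  refine (cls_eq_iff _ _).2 ⟨Representation.Equiv.mk
    (LinearEquiv.ofLinearMap (ρ k) (ρ k⁻¹)
      (by rw [← Module.End.mul_eq_comp, ← map_mul]; simp [Module.End.one_eq_id])
      (by rw [← Module.End.mul_eq_comp, ← map_mul]; simp [Module.End.one_eq_id])) fun x => ?_⟩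
  change ρ k * ρ (ψ x) = ρ (φ x) * ρ k
  rw [← map_mul, ← map_mul, h]
  congr 1
  group

end RepRing

/-- The complex representation ring `R(H)` (as an abelian group): the Grothendieck group of the
monoid of isomorphism classes of finite dimensional complex representations of `H`. -/
abbrev RepRing (H : Type u) [Group H] : Type u :=
  Algebra.GrothendieckAddGroup (RepRing.RepClass H)

namespace RepRing

variable {H K L : Type u} [Group H] [Group K] [Group L]

/-- Restriction `R(K) → R(H)` along a homomorphism `H → K`. -/
def res (φ : H →* K) : RepRing K →+ RepRing H :=
  Algebra.GrothendieckAddGroup.lift (Algebra.GrothendieckAddGroup.of.comp (resClass φ))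

theorem hom_ext {A : Type*} [AddCommGroup A] {f g : RepRing H →+ A}
    (h : ∀ x : RepClass H, f (Algebra.GrothendieckAddGroup.of x)
      = g (Algebra.GrothendieckAddGroup.of x)) : f = g :=
  Algebra.GrothendieckAddGroup.lift.symm.injective (AddMonoidHom.ext h)

theorem res_of (φ : H →* K) (x : RepClass K) :
    res φ (Algebra.GrothendieckAddGroup.of x)
      = Algebra.GrothendieckAddGroup.of (resClass φ x) :=
  DFunLike.congr_fun (Algebra.GrothendieckAddGroup.lift.symm_apply_apply
    (Algebra.GrothendieckAddGroup.of.comp (resClass φ))) x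

theorem res_id : res (MonoidHom.id H) = AddMonoidHom.id _ := by
  apply hom_ext
  intro x
  rw [res_of]
  induction x using ind_cls with | _ n ρ
  rw [resClass_cls]; rfl

theorem res_comp (φ : H →* K) (ψ : K →* L) : res (ψ.comp φ) = (res φ).comp (res ψ) := by
  apply hom_ext
  intro x
  rw [AddMonoidHom.comp_apply, res_of, res_of, res_of]
  induction x using ind_cls with | _ n ρ
  rw [resClass_cls, resClass_cls, resClass_cls]; rfl

theorem res_conj (φ ψ : H →* K) (k : K) (h : ∀ x, ψ x = k⁻¹ * φ x * k) : res ψ = res φ := by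
  rw [res, res, resClass_conj φ ψ k h]

end RepRing

/-! ### The orbit category and the representation ring functor -/

/-- The orbit category of `G` for the family of finite subgroups: an object is a transitive
`G`-set `G ⧸ H` with `H` finite. -/
structure OrbitCat (G : Type u) [Group G] where
  /-- The isotropy group. -/
  H : Subgroup G
  finite : Finite H

namespace OrbitCat

variable {G : Type u} [Group G]

/-- Morphisms of the orbit category are `G`-equivariant maps. -/
instance : Category.{u} (OrbitCat G) where
  Hom X Y := (G ⧸ X.H) →[G] (G ⧸ Y.H)
  id X := MulActionHom.id G
  comp f g := g.comp f

/-- The underlying equivariant map of a morphism. -/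
def toHom {X Y : OrbitCat G} (f : X ⟶ Y) : (G ⧸ X.H) →[G] (G ⧸ Y.H) := f

/-- An element `a` of `G` with `f (H) = a K`, for a `G`-map `f : G ⧸ H → G ⧸ K`. -/
def rep {X Y : OrbitCat G} (f : X ⟶ Y) : G :=
  Quotient.out (toHom f ((1 : G) : G ⧸ X.H))

theorem mk_rep {X Y : OrbitCat G} (f : X ⟶ Y) :
    ((rep f : G) : G ⧸ Y.H) = toHom f ((1 : G) : G ⧸ X.H) :=
  Quotient.out_eq' _

theorem apply_mk {X Y : OrbitCat G} (f : X ⟶ Y) (g : G) :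
    toHom f (g : G ⧸ X.H) = ((g * rep f : G) : G ⧸ Y.H) := by
  have h := map_smul (toHom f) g ((1 : G) : G ⧸ X.H)
  rw [← mk_rep, MulAction.Quotient.smul_coe, MulAction.Quotient.smul_coe, smul_eq_mul,
    smul_eq_mul, mul_one] at h
  exact h

theorem conj_mem {X Y : OrbitCat G} (f : X ⟶ Y) (h : X.H) :
    (rep f)⁻¹ * (h : G) * rep f ∈ Y.H := by
  have e : ((h : G) : G ⧸ X.H) = ((1 : G) : G ⧸ X.H) := by
    rw [eq_comm, QuotientGroup.eq]; simp
  have := apply_mk f (h : G)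
  rw [e, ← mk_rep, QuotientGroup.eq] at this
  simpa [mul_assoc] using this

/-- The homomorphism `H → K`, `h ↦ a⁻¹ h a`, attached to a `G`-map `G ⧸ H → G ⧸ K`, `H ↦ a K`. -/
def conjHom {X Y : OrbitCat G} (f : X ⟶ Y) : X.H →* Y.H where
  toFun h := ⟨(rep f)⁻¹ * (h : G) * rep f, conj_mem f h⟩
  map_one' := by ext; simp
  map_mul' a b := by ext; simp [mul_assoc]

end OrbitCat

/-- The contravariant functor `G ⧸ H ↦ R(H)` from the orbit category to abelian groups. A `G`-map
`G ⧸ H → G ⧸ K`, `H ↦ a K`, is sent to restriction along `H → K`, `h ↦ a⁻¹ h a`; this does not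
depend on the choice of `a` in its coset. -/
def repRingFunctor (G : Type u) [Group G] : (OrbitCat G)ᵒᵖ ⥤ ModuleCat.{u} ℤ where
  obj X := ModuleCat.of ℤ (RepRing X.unop.H)
  map f := ModuleCat.ofHom (RepRing.res (OrbitCat.conjHom f.unop)).toIntLinearMap
  map_id X := by
    have h : RepRing.res (OrbitCat.conjHom (𝟙 X.unop)) = AddMonoidHom.id _ := by
      have hm : OrbitCat.rep (𝟙 X.unop) ∈ X.unop.H := by
        have h1 : ((OrbitCat.rep (𝟙 X.unop) : G) : G ⧸ X.unop.H) = ((1 : G) : G ⧸ X.unop.H) :=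
          OrbitCat.mk_rep (𝟙 X.unop)
        rw [eq_comm, QuotientGroup.eq] at h1
        simpa using h1
      rw [← RepRing.res_id]
      exact RepRing.res_conj _ _ ⟨_, hm⟩ fun x => by ext; rfl
    rw [unop_id, h]; rfl
  map_comp {X Y Z} f g := by
    have h : RepRing.res (OrbitCat.conjHom (g.unop ≫ f.unop))
        = (RepRing.res (OrbitCat.conjHom g.unop)).comp
          (RepRing.res (OrbitCat.conjHom f.unop)) := by
      have hm : (OrbitCat.rep g.unop * OrbitCat.rep f.unop)⁻¹ *
          OrbitCat.rep (g.unop ≫ f.unop) ∈ X.unop.H := by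
        rw [← QuotientGroup.eq, ← OrbitCat.apply_mk, OrbitCat.mk_rep, OrbitCat.mk_rep]
        rfl
      rw [← RepRing.res_comp]
      refine RepRing.res_conj _ _ ⟨_, hm⟩ fun x => ?_
      ext
      simp [OrbitCat.conjHom, mul_assoc]
    rw [unop_comp, h]; rfl

/-! ### Bredon cohomology of the geometric realization of a `G`-poset

Let `G` act on a poset `P` by order preserving maps. The geometric realization `|P|` is the
simplicial complex whose `n`-simplices are the chains `p₀ < ⋯ < pₙ` of `P`. An element of `G` that
maps a simplex to itself fixes it pointwise, so that `|P|` is a `G`-CW-complex whose `n`-cells are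
these simplices, and the fixed point set `|P|ᴴ` is the subcomplex of the simplices fixed
by `H`. -/

/-- The `n`-cells of `|P|`: the chains `p₀ < ⋯ < pₙ`. -/
structure Chain (P : Type u) [PartialOrder P] (n : ℕ) where
  /-- The vertices. -/
  vert : Fin (n + 1) → P
  strictMono : StrictMono vert

namespace Chain

variable {P : Type u} [PartialOrder P]

@[ext]
theorem ext' {n : ℕ} {c d : Chain P n} (h : ∀ i, c.vert i = d.vert i) : c = d := by
  cases c; cases d; congr; exact funext h

/-- The `i`-th face: omit `pᵢ`. -/
def face {n : ℕ} (i : Fin (n + 2)) (c : Chain P (n + 1)) : Chain P n :=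
  ⟨fun j => c.vert (i.succAbove j), c.strictMono.comp (Fin.strictMono_succAbove i)⟩

variable {G : Type u} [Group G] [MulAction G P] [CovariantClass G P (· • ·) (· ≤ ·)]

instance (n : ℕ) : MulAction G (Chain P n) where
  smul g c := ⟨fun j => g • c.vert j, fun _ _ hij =>
    lt_of_le_of_ne (CovariantClass.elim g (c.strictMono hij).le)
      fun h => (c.strictMono hij).ne (MulAction.injective g h)⟩
  one_smul c := Chain.ext' fun i => one_smul G (c.vert i)
  mul_smul g h c := Chain.ext' fun i => mul_smul g h (c.vert i)

theorem smul_vert {n : ℕ} (g : G) (c : Chain P n) (i : Fin (n + 1)) :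
    (g • c).vert i = g • c.vert i := rfl

/-- The face maps are equivariant. -/
def faceHom (G : Type u) [Group G] (P : Type u) [PartialOrder P] [MulAction G P]
    [CovariantClass G P (· • ·) (· ≤ ·)] {n : ℕ} (i : Fin (n + 2)) :
    Chain P (n + 1) →[G] Chain P n where
  toFun := face i
  map_smul' _ _ := rfl

end Chain

namespace Bredon

variable (G : Type u) [Group G] (P : Type u) [PartialOrder P] [MulAction G P]
  [CovariantClass G P (· • ·) (· ≤ ·)]

/-- The free abelian group functor. -/
def free : Type u ⥤ ModuleCat.{u} ℤ where
  obj X := ModuleCat.of ℤ (X →₀ ℤ)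
  map f := ModuleCat.ofHom (Finsupp.lmapDomain ℤ ℤ f)
  map_id X := by ext : 1; exact Finsupp.lmapDomain_id ℤ ℤ
  map_comp f g := by ext : 1; exact Finsupp.lmapDomain_comp ℤ ℤ f g

/-- The presheaf of sets `G ⧸ H ↦ Map_G(G ⧸ H, {n-cells of |P|})` on the orbit category; its value
at `G ⧸ H` is the set of `n`-cells of `|P|ᴴ`, via evaluation at the coset `H`. -/
def fixedCells (n : ℕ) : (OrbitCat G)ᵒᵖ ⥤ Type u where
  obj X := (G ⧸ X.unop.H) →[G] Chain P n
  map f := ↾fun c => MulActionHom.comp c (OrbitCat.toHom f.unop)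

/-- The `i`-th face map, as a map of presheaves. -/
def fixedFace {n : ℕ} (i : Fin (n + 2)) : fixedCells G P (n + 1) ⟶ fixedCells G P n where
  app X := ↾fun c => MulActionHom.comp (Chain.faceHom G P i) c

/-- The cellular chain modules `G ⧸ H ↦ Cₙ(|P|ᴴ)` over the orbit category: free abelian groups on
the `n`-cells of the fixed point sets. -/
def cells (n : ℕ) : (OrbitCat G)ᵒᵖ ⥤ ModuleCat.{u} ℤ :=
  fixedCells G P n ⋙ free

/-- The `i`-th face map on cellular chains. -/
def cellFace {n : ℕ} (i : Fin (n + 2)) : cells G P (n + 1) ⟶ cells G P n :=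
  Functor.whiskerRight (fixedFace G P i) free

/-- The cellular boundary map `∂(p₀ < ⋯ < pₙ₊₁) = ∑ᵢ (-1)ⁱ (p₀ < ⋯ p̂ᵢ ⋯ < pₙ₊₁)`. -/
def boundary (n : ℕ) : cells G P (n + 1) ⟶ cells G P n :=
  ∑ i : Fin (n + 2), (-1 : ℤ) ^ (i : ℕ) • cellFace G P i

theorem fixedFace_comp {n : ℕ} {i : Fin (n + 2)} {j : Fin (n + 3)} (h : j ≤ i.castSucc) :
    fixedFace G P j ≫ fixedFace G P i =
      fixedFace G P i.succ ≫ fixedFace G P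
        (Fin.castLT j (lt_of_le_of_lt (Fin.le_def.1 h) i.isLt)) := by
  ext X c
  apply MulActionHom.ext
  intro x
  apply Chain.ext'
  intro k
  change (MulActionHom.toFun c x).vert (j.succAbove (i.succAbove k))
    = (MulActionHom.toFun c x).vert (i.succ.succAbove ((Fin.castLT j _).succAbove k))
  congr 1
  ext
  rw [Fin.le_def] at h
  simp only [Fin.succAbove, Fin.lt_def, Fin.val_castSucc, Fin.val_succ, Fin.val_castLT] at *
  split_ifs <;> simp at * <;> omega

theorem cellFace_comp {n : ℕ} {i : Fin (n + 2)} {j : Fin (n + 3)} (h : j ≤ i.castSucc) :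
    cellFace G P j ≫ cellFace G P i =
      cellFace G P i.succ ≫ cellFace G P
        (Fin.castLT j (lt_of_le_of_lt (Fin.le_def.1 h) i.isLt)) := by
  unfold cellFace cells
  rw [← Functor.whiskerRight_comp, fixedFace_comp G P h, Functor.whiskerRight_comp]

theorem boundary_comp_boundary (n : ℕ) : boundary G P (n + 1) ≫ boundary G P n = 0 := by
  unfold boundary
  simp only [Preadditive.comp_sum, Preadditive.sum_comp, ← Finset.sum_product']
  let Q := Fin (n + 2) × Fin (n + 3)
  let S : Finset Q := {ij : Q | (ij.2 : ℕ) ≤ (ij.1 : ℕ)}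
  rw [Finset.univ_product_univ, ← Finset.sum_add_sum_compl S, ← eq_neg_iff_add_eq_zero,
    ← Finset.sum_neg_distrib]
  let φ : ∀ ij : Q, ij ∈ S → Q := fun ij hij =>
    (Fin.castLT ij.2 (lt_of_le_of_lt (Finset.mem_filter.mp hij).right (Fin.is_lt ij.1)), ij.1.succ)
  apply Finset.sum_bij φ
  · intro ij hij
    simp_rw [S, φ, Finset.compl_filter, Finset.mem_filter_univ, Fin.val_succ,
      Fin.val_castLT] at hij ⊢
    omega
  · rintro ⟨i, j⟩ hij ⟨i', j'⟩ hij' h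
    rw [Prod.mk_inj]
    exact ⟨by simpa [φ] using! congr_arg Prod.snd h,
      by simpa [φ, Fin.castSucc_castLT] using! congr_arg Fin.castSucc (congr_arg Prod.fst h)⟩
  · rintro ⟨i', j'⟩ hij'
    simp_rw [S, Finset.compl_filter, Finset.mem_filter_univ, not_le] at hij'
    refine ⟨(j'.pred <| ?_, Fin.castSucc i'), ?_, ?_⟩
    · rintro rfl
      simp only [Fin.val_zero, not_lt_zero] at hij'
    · simpa [S] using! Nat.le_sub_one_of_lt hij'
    · simp only [φ, Fin.castLT_castSucc, Fin.succ_pred]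
  · rintro ⟨i, j⟩ hij
    have hle : j ≤ i.castSucc := by simpa [S] using! hij
    dsimp
    simp only [Preadditive.zsmul_comp, Preadditive.comp_zsmul, smul_smul, ← neg_smul]
    congr 1
    · simp only [φ, Fin.val_succ, pow_add, pow_one, mul_neg, neg_neg, mul_one]
      apply mul_comm
    · rw [cellFace_comp G P hle]

/-- The cellular chain complex `G ⧸ H ↦ C_*(|P|ᴴ)` of `|P|` over the orbit category. -/
def chainComplex : ChainComplex ((OrbitCat G)ᵒᵖ ⥤ ModuleCat.{u} ℤ) ℕ :=
  ChainComplex.of (cells G P) (boundary G P) (boundary_comp_boundary G P)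

/-- The Bredon cochain complex of `|P|` with coefficients in `M`: the groups of natural
transformations from `G ⧸ H ↦ Cₙ(|P|ᴴ)` to `M`, with the coboundary induced by `∂`. -/
def cochainComplex (M : (OrbitCat G)ᵒᵖ ⥤ ModuleCat.{u} ℤ) : CochainComplex (ModuleCat.{u} ℤ) ℕ :=
  (chainComplex G P).linearYonedaObj ℤ M

/-- The Bredon cohomology group `Hⁿ_G(|P|; M)`. -/
def cohomology (M : (OrbitCat G)ᵒᵖ ⥤ ModuleCat.{u} ℤ) (n : ℕ) : ModuleCat.{u} ℤ :=
  (cochainComplex G P M).homology n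

end Bredon

/-! ### Right angled Coxeter groups and the Davis complex -/

namespace RACG

open scoped Pointwise

variable {V : Type u} (Γ : SimpleGraph V)

open scoped Classical in
/-- The Coxeter matrix of a graph: `m(s,s) = 1`, `m(s,t) = 2` if `s` and `t` are adjacent, and
`m(s,t) = ∞` (which is encoded as `0`, no relation) otherwise. -/
def coxeterMatrix : CoxeterMatrix V where
  M := Matrix.of fun s t => if s = t then 1 else if Γ.Adj s t then 2 else 0
  isSymm := by
    ext s t
    simp [Matrix.transpose_apply, eq_comm, Γ.adj_comm]
  diagonal := by simp
  off_diagonal s t h := by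
    simp only [Matrix.of_apply, if_neg h]
    split_ifs <;> simp

/-- The right angled Coxeter group
`W = ⟨V | s² for s ∈ V, (st)² for adjacent s, t⟩` of the graph `Γ`. -/
abbrev W : Type u := (coxeterMatrix Γ).Group

/-- The subgroup `W_J` generated by a set `J` of vertices. -/
def parabolic (J : Set V) : Subgroup (W Γ) :=
  Subgroup.closure ((coxeterMatrix Γ).simple '' J)

/-- `J` is spherical if `W_J` is finite. -/
def IsSpherical (J : Set V) : Prop := Finite (parabolic Γ J)

/-- The set of spherical subgroups `W_J`. -/
def sphericalSubgroups : Set (Subgroup (W Γ)) :=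
  {K | ∃ J : Set V, IsSpherical Γ J ∧ K = parabolic Γ J}

/-- The spherical cosets `w W_J`. As a set of subsets of `W`, it is partially ordered by inclusion.
The Davis complex is the geometric realization of this poset. -/
def SphericalCoset : Type u :=
  {A : Set (W Γ) // ∃ (w : W Γ) (J : Set V), IsSpherical Γ J ∧ A = w • (parabolic Γ J : Set (W Γ))}

instance : PartialOrder (SphericalCoset Γ) := inferInstanceAs (PartialOrder (Subtype _))

/-- `W` acts on the spherical cosets by left multiplication. -/
instance : MulAction (W Γ) (SphericalCoset Γ) where
  smul g A := ⟨g • A.1, by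
    obtain ⟨w, J, hJ, h⟩ := A.2
    exact ⟨g * w, J, hJ, by rw [h, mul_smul]⟩⟩
  one_smul A := Subtype.ext (one_smul _ A.1)
  mul_smul g h A := Subtype.ext (mul_smul g h A.1)

instance : CovariantClass (W Γ) (SphericalCoset Γ) (· • ·) (· ≤ ·) where
  elim g _ _ h := Set.smul_set_mono (a := g) h

/-- The Bredon cohomology `Hⁿ_W(Σ; R(-))` of the Davis complex `Σ` with coefficients in the complex
representation ring functor. -/
def davisCohomology (n : ℕ) : ModuleCat.{u} ℤ :=
  Bredon.cohomology (W Γ) (SphericalCoset Γ) (repRingFunctor (W Γ)) n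

end RACG

end

noncomputable section

/-! ### Right angled Coxeter groups: sign characters and special subgroups -/

namespace RACG

open scoped Pointwise

variable {V : Type u} (Γ : SimpleGraph V)

/-! The chains of spherical subsets `J₀ < ⋯ < Jₙ` index a strict fundamental domain of the Davis
complex, and the chain has isotropy group `W_{J₀}` (`isFundamental_stdChain`). By Yoneda a Bredon
cochain is therefore a free choice of one element of `R(W_{J₀})` for each chain.

For `J` spherical, `W_J` is generated by commuting involutions, and its representations are sums of
sign characters. Instead of the multiplicities of characters, the proof uses as coordinates on
`R(W_J)`, one for each `I ⊆ J`, the dimension of the space on which all generators in `I` act by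
`-1`. The change of coordinates is unitriangular, so these are again integral coordinates
(`negDim_bijective`). Their advantage is that restriction from `W_K` to `W_J` preserves the
coordinate `I` whenever `I ⊆ J ⊆ K` (`negDim_map_proj`).

Hence the Bredon complex splits as a product over spherical `I` of the simplicial cochain complexes
of the posets of spherical sets containing `I` (`coord_boundary`). Each such poset has the least
element `I`, so it is a cone: its cohomology is `ℤ` in degree `0` (`bijective_coord_single`) and
vanishes above (`Chain.sum_contract_face`). This gives one copy of `ℤ` for each spherical subset,
and `J ↦ W_J` is injective. -/

theorem coxeterMatrix_isLiftable {M : Type*} [Monoid M] (f : V → M)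
    (hsq : ∀ s, f s * f s = 1) (hadj : ∀ s t, Γ.Adj s t → (f s * f t) ^ 2 = 1) :
    (coxeterMatrix Γ).IsLiftable f := by
  classical
  intro s t
  change (f s * f t) ^ (if s = t then 1 else if Γ.Adj s t then 2 else 0) = 1
  split_ifs with h h'
  · subst h; simp [hsq]
  · exact hadj s t h'
  · simp

/-- The homomorphism from `W` given by images of the generators that satisfy the relations. -/
def lift {M : Type*} [Monoid M] (f : V → M)
    (hsq : ∀ s, f s * f s = 1) (hadj : ∀ s t, Γ.Adj s t → (f s * f t) ^ 2 = 1) : W Γ →* M :=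
  (coxeterMatrix Γ).toCoxeterSystem.lift ⟨f, coxeterMatrix_isLiftable Γ f hsq hadj⟩

theorem lift_simple {M : Type*} [Monoid M] (f : V → M)
    (hsq : ∀ s, f s * f s = 1) (hadj : ∀ s t, Γ.Adj s t → (f s * f t) ^ 2 = 1) (s : V) :
    lift Γ f hsq hadj ((coxeterMatrix Γ).simple s) = f s :=
  (coxeterMatrix Γ).toCoxeterSystem.lift_apply_simple _ s

theorem simple_mul_self (s : V) :
    (coxeterMatrix Γ).simple s * (coxeterMatrix Γ).simple s = 1 :=
  (coxeterMatrix Γ).toCoxeterSystem.simple_mul_simple_self s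

open scoped Classical in
/-- The sign character of `W` that is `-1` on the generators in `T` and `1` on the others. -/
def signChar (T : Set V) : W Γ →* ℂ :=
  lift Γ (fun s => if s ∈ T then -1 else 1) (fun s => by split_ifs <;> simp)
    (fun s t _ => by split_ifs <;> simp)

open scoped Classical in
theorem signChar_simple (T : Set V) (s : V) :
    signChar Γ T ((coxeterMatrix Γ).simple s) = if s ∈ T then -1 else 1 :=
  lift_simple Γ _ _ _ s

/-- The sign character of `{s}` kills every generator other than `s`, hence all of `W_J` when `s ∉
J`, but it takes the value `-1` at `s`. -/
theorem simple_mem_parabolic_iff {J : Set V} {s : V} :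
    (coxeterMatrix Γ).simple s ∈ parabolic Γ J ↔ s ∈ J := by
  refine ⟨fun h => ?_, fun h => Subgroup.subset_closure ⟨s, h, rfl⟩⟩
  by_contra hs
  have hle : parabolic Γ J ≤ (signChar Γ {s}).ker := by
    refine (Subgroup.closure_le _).2 ?_
    rintro _ ⟨t, ht, rfl⟩
    have : t ≠ s := fun e => hs (e ▸ ht)
    simp [MonoidHom.mem_ker, signChar_simple, this]
  have := hle h
  rw [MonoidHom.mem_ker, signChar_simple] at this
  norm_num at this

theorem parabolic_le_iff {I J : Set V} : parabolic Γ I ≤ parabolic Γ J ↔ I ⊆ J := by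
  refine ⟨fun h s hs => ?_, fun h => Subgroup.closure_mono (Set.image_mono h)⟩
  exact (simple_mem_parabolic_iff Γ).1 (h ((simple_mem_parabolic_iff Γ).2 hs))

theorem parabolic_injective : Function.Injective (parabolic Γ) := fun _ _ h =>
  Set.Subset.antisymm ((parabolic_le_iff Γ).1 h.le) ((parabolic_le_iff Γ).1 h.ge)

variable {Γ} in
theorem IsSpherical.mono {I J : Set V} (hJ : IsSpherical Γ J) (h : I ⊆ J) : IsSpherical Γ I :=
  have : Finite (parabolic Γ J) := hJ
  Finite.of_injective _ (Subgroup.inclusion_injective ((parabolic_le_iff Γ).2 h))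

-- If `s` and `t` were not adjacent, `W` would map to the infinite dihedral group `DihedralGroup 0`,
-- with `s` and `t` going to two reflections and all other generators to `1`. The image of `s * t`
-- is then a rotation of infinite order, which a finite `W_J` cannot contain.
variable {Γ} in
theorem IsSpherical.adj {J : Set V} (hJ : IsSpherical Γ J) {s t : V} (hs : s ∈ J) (ht : t ∈ J)
    (hst : s ≠ t) : Γ.Adj s t := by
  classical
  by_contra hadj
  let f : V → DihedralGroup 0 := fun v =>
    if v = s then .sr 0 else if v = t then .sr 1 else 1
  have hsq : ∀ v, f v * f v = 1 := by
    intro v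
    simp only [f]
    split_ifs
    · exact DihedralGroup.sr_mul_self _
    · exact DihedralGroup.sr_mul_self _
    · exact one_mul _
  have hpair : ∀ v w, Γ.Adj v w → (f v * f w) ^ 2 = 1 := by
    intro v w hvw
    have : f v = 1 ∨ f w = 1 := by
      by_contra! h
      have hv : v = s ∨ v = t := by by_contra! h'; exact h.1 (by simp [f, h'])
      have hw : w = s ∨ w = t := by by_contra! h'; exact h.2 (by simp [f, h'])
      rcases hv with rfl | rfl <;> rcases hw with rfl | rfl
      · exact hvw.ne rfl
      · exact hadj hvw
      · exact hadj hvw.symm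
      · exact hvw.ne rfl
    rcases this with h | h <;> simp [h, pow_two, hsq]
  let g : parabolic Γ J :=
    ⟨_, (simple_mem_parabolic_iff Γ).2 hs⟩ * ⟨_, (simple_mem_parabolic_iff Γ).2 ht⟩
  have : Finite (parabolic Γ J) := hJ
  have hfin : IsOfFinOrder g := isOfFinOrder_of_finite g
  have hfin' := ((lift Γ f hsq hpair).comp (parabolic Γ J).subtype).isOfFinOrder hfin
  have hg : ((lift Γ f hsq hpair).comp (parabolic Γ J).subtype) g = .r 1 := by
    simp [g, lift_simple, f, hst.symm]
  rw [hg] at hfin'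
  -- Order `0` here means infinite order.
  have := DihedralGroup.orderOf_r_one (n := 0)
  exact (orderOf_pos_iff.2 hfin').ne' this

variable {Γ} in
theorem IsSpherical.commute_simple {J : Set V} (hJ : IsSpherical Γ J) {s t : V} (hs : s ∈ J)
    (ht : t ∈ J) : Commute ((coxeterMatrix Γ).simple s) ((coxeterMatrix Γ).simple t) := by
  rcases eq_or_ne s t with rfl | hst
  · exact Commute.refl _
  · have h := (coxeterMatrix Γ).toCoxeterSystem.simple_mul_simple_pow s t
    have hm : (coxeterMatrix Γ) s t = 2 := by
      classical
      change (if s = t then 1 else if Γ.Adj s t then 2 else 0) = 2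
      rw [if_neg hst, if_pos (hJ.adj hs ht hst)]
    rw [hm, pow_two] at h
    have h1 := eq_inv_of_mul_eq_one_left h
    have hi : ∀ v, ((coxeterMatrix Γ).simple v)⁻¹ = (coxeterMatrix Γ).simple v := fun v =>
      inv_eq_of_mul_eq_one_left (simple_mul_self Γ v)
    refine h1.trans ((mul_inv_rev _ _).trans ?_)
    rw [CoxeterMatrix.toCoxeterSystem_simple, hi, hi]

end RACG

/-! ### Coordinates on the representation ring of a group of commuting involutions -/

namespace RepRing

open Algebra (GrothendieckAddGroup)

variable {H K : Type u} [Group H] [Group K]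

section NegDim

variable {V U : Type*} [AddCommGroup V] [Module ℂ V] [AddCommGroup U] [Module ℂ U]

/-- The subspace on which all elements of `A` act as `-1`. -/
def negSpace (ρ : Representation ℂ H V) (A : Set H) : Submodule ℂ V :=
  ⨅ a ∈ A, LinearMap.ker (ρ a + 1)

theorem mem_negSpace {ρ : Representation ℂ H V} {A : Set H} {v : V} :
    v ∈ negSpace ρ A ↔ ∀ a ∈ A, ρ a v = -v := by
  simp [negSpace, Submodule.mem_iInf, eq_neg_iff_add_eq_zero]

theorem finrank_negSpace_congr {ρ : Representation ℂ H V} {σ : Representation ℂ H U}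
    (e : ρ.Equiv σ) (A : Set H) :
    Module.finrank ℂ (negSpace ρ A) = Module.finrank ℂ (negSpace σ A) := by
  have he : ∀ a v, e.toLinearEquiv (ρ a v) = σ a (e.toLinearEquiv v) := fun a v =>
    LinearMap.congr_fun (e.toIntertwiningMap.isIntertwining' a) v
  refine (LinearEquiv.ofSubmodules e.toLinearEquiv _ _ ?_).finrank_eq
  ext w
  constructor
  · rintro ⟨v, hv, rfl⟩
    refine mem_negSpace.2 fun a ha => ?_
    have := he a v
    rw [mem_negSpace.1 hv a ha, map_neg] at this
    exact this.symm
  · intro hw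
    refine ⟨e.toLinearEquiv.symm w, mem_negSpace.2 fun a ha => ?_,
      e.toLinearEquiv.apply_symm_apply w⟩
    apply e.toLinearEquiv.injective
    rw [he, map_neg, e.toLinearEquiv.apply_symm_apply, mem_negSpace.1 hw a ha]

theorem finrank_negSpace_prod [FiniteDimensional ℂ V] [FiniteDimensional ℂ U]
    (ρ : Representation ℂ H V) (σ : Representation ℂ H U) (A : Set H) :
    Module.finrank ℂ (negSpace (ρ.prod σ) A)
      = Module.finrank ℂ (negSpace ρ A) + Module.finrank ℂ (negSpace σ A) := by
  rw [← Module.finrank_prod]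
  have h : ∀ x : V × U, x ∈ negSpace (ρ.prod σ) A ↔ x.1 ∈ negSpace ρ A ∧ x.2 ∈ negSpace σ A := by
    rintro ⟨v, w⟩
    simp only [mem_negSpace, Representation.prod, MonoidHom.coe_mk, OneHom.coe_mk,
      LinearMap.prodMap_apply, Prod.neg_mk, Prod.mk.injEq]
    exact ⟨fun h => ⟨fun a ha => (h a ha).1, fun a ha => (h a ha).2⟩,
      fun h a ha => ⟨h.1 a ha, h.2 a ha⟩⟩
  exact LinearEquiv.finrank_eq
    { toFun x := (⟨x.1.1, ((h _).1 x.2).1⟩, ⟨x.1.2, ((h _).1 x.2).2⟩)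
      invFun y := ⟨(y.1.1, y.2.1), (h _).2 ⟨y.1.2, y.2.2⟩⟩
      map_add' _ _ := rfl
      map_smul' _ _ := rfl
      left_inv _ := rfl
      right_inv _ := rfl }

end NegDim

/-- The dimension of the subspace on which all elements of `A` act as `-1`, as an additive
invariant of isomorphism classes of representations. -/
def negDimClass (A : Set H) : RepClass H →+ ℤ where
  toFun := Quotient.lift (fun ρ => (Module.finrank ℂ (negSpace ρ.2 A) : ℤ)) fun _ _ ⟨e⟩ =>
    congrArg _ (finrank_negSpace_congr e A)
  map_zero' := by
    change ((Module.finrank ℂ (negSpace (model _).2 A) : ℕ) : ℤ) = 0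
    rw [← finrank_negSpace_congr (modelEquiv (1 : Representation ℂ H (Fin 0 → ℂ))) A,
      Module.finrank_zero_of_subsingleton, Nat.cast_zero]
  map_add' x y := by
    induction x using Quotient.ind with | _ ρ
    induction y using Quotient.ind with | _ σ
    change ((Module.finrank ℂ (negSpace (model _).2 A) : ℕ) : ℤ) =
      (Module.finrank ℂ (negSpace ρ.2 A) : ℤ) + (Module.finrank ℂ (negSpace σ.2 A) : ℤ)
    rw [← finrank_negSpace_congr (modelEquiv (ρ.2.prod σ.2)) A, finrank_negSpace_prod,
      Nat.cast_add]

theorem negDimClass_cls (A : Set H) {V : Type*} [AddCommGroup V] [Module ℂ V]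
    [FiniteDimensional ℂ V] (ρ : Representation ℂ H V) :
    negDimClass A (cls ρ) = Module.finrank ℂ (negSpace ρ A) :=
  congrArg _ (finrank_negSpace_congr (modelEquiv ρ) A).symm

/-- The dimension of the subspace on which all elements of `A` act as `-1`, on virtual
representations. -/
def negDim (A : Set H) : RepRing H →+ ℤ := GrothendieckAddGroup.lift (negDimClass A)

theorem negDim_of (A : Set H) (x : RepClass H) :
    negDim A (GrothendieckAddGroup.of x) = negDimClass A x :=
  DFunLike.congr_fun (GrothendieckAddGroup.lift.symm_apply_apply (negDimClass A)) x

/-- The condition on a vector involves only the operators of the elements `φ a`, so the two negative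
spaces are the same subspace. -/
theorem negDim_res (φ : H →* K) (A : Set H) (x : RepRing K) :
    negDim A (res φ x) = negDim (φ '' A) x := by
  suffices (negDim A).comp (res φ) = negDim (φ '' A) from DFunLike.congr_fun this x
  apply hom_ext
  intro x
  rw [AddMonoidHom.comp_apply, res_of, negDim_of, negDim_of]
  induction x using ind_cls with | _ n ρ
  rw [resClass_cls, negDimClass_cls, negDimClass_cls]
  have : negSpace (MonoidHom.comp ρ φ : Representation ℂ H _) A = negSpace ρ (φ '' A) := by
    ext v
    simp [mem_negSpace]
  rw [this]

/-- The representation on `V` by scalars given by a character. -/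
def scalarRep (χ : H →* ℂ) (V : Type*) [AddCommGroup V] [Module ℂ V] : Representation ℂ H V :=
  (algebraMap ℂ (Module.End ℂ V)).toMonoidHom.comp χ

theorem scalarRep_apply (χ : H →* ℂ) {V : Type*} [AddCommGroup V] [Module ℂ V] (h : H) (v : V) :
    scalarRep χ V h v = χ h • v := rfl

/-- Scalars commute with every linear map, so any linear splitting of `V` into lines is a splitting
of representations. -/
theorem cls_scalarRep (χ : H →* ℂ) (n : ℕ) (V : Type) [AddCommGroup V] [Module ℂ V]
    [FiniteDimensional ℂ V] (hn : Module.finrank ℂ V = n) :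
    cls (scalarRep χ V) = n • cls (scalarRep χ ℂ) := by
  induction n generalizing V with
  | zero =>
    have : Subsingleton V := Module.finrank_zero_iff.1 hn
    rw [zero_smul]
    refine (cls_eq_iff (scalarRep χ V) (1 : Representation ℂ H (Fin 0 → ℂ))).2
      ⟨Representation.Equiv.mk (LinearEquiv.ofFinrankEq V (Fin 0 → ℂ) (by simpa using hn)) ?_⟩
    intro h
    ext v i
    exact i.elim0
  | succ n ih =>
    rw [succ_nsmul', ← ih (Fin n → ℂ) (by simp), cls_add]
    let e : V ≃ₗ[ℂ] ℂ × (Fin n → ℂ) :=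
      LinearEquiv.ofFinrankEq _ _ (by simp [hn, add_comm])
    exact (cls_eq_iff _ _).2 ⟨Representation.Equiv.mk e fun h =>
      LinearMap.ext fun v => map_smul e (χ h) v⟩

section Involutions

variable {ι : Type*} {s : ι → H}

theorem commute_of_closure_eq_top (hcomm : ∀ i j, Commute (s i) (s j))
    (hgen : Subgroup.closure (Set.range s) = ⊤) (i : ι) (h : H) : Commute (s i) h := by
  have : Subgroup.closure (Set.range s) ≤ Subgroup.centralizer {s i} := by
    refine (Subgroup.closure_le _).2 ?_
    rintro _ ⟨j, rfl⟩
    rw [SetLike.mem_coe, Subgroup.mem_centralizer_singleton_iff]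
    exact hcomm j i
  have := this (hgen ▸ Subgroup.mem_top h)
  rw [Subgroup.mem_centralizer_singleton_iff] at this
  exact this.symm

theorem isCompl_ker_of_mul_self_eq_one {V : Type*} [AddCommGroup V] [Module ℂ V]
    (f : Module.End ℂ V) (hf : f * f = 1) :
    IsCompl (LinearMap.ker (f - 1)) (LinearMap.ker (f + 1)) := by
  have hff : ∀ v, f (f v) = v := fun v => LinearMap.congr_fun hf v
  constructor
  · rw [Submodule.disjoint_def]
    intro v h1 h2
    rw [LinearMap.mem_ker, LinearMap.sub_apply, Module.End.one_apply, sub_eq_zero] at h1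
    rw [LinearMap.mem_ker, LinearMap.add_apply, Module.End.one_apply, h1] at h2
    rw [← two_smul ℂ v] at h2
    exact (smul_eq_zero.1 h2).resolve_left two_ne_zero
  · rw [codisjoint_iff, eq_top_iff]
    intro v _
    refine Submodule.mem_sup.2 ⟨(1 / 2 : ℂ) • (v + f v), ?_, (1 / 2 : ℂ) • (v - f v), ?_, ?_⟩
    · simp only [LinearMap.mem_ker, LinearMap.sub_apply, map_smul, map_add, hff,
        Module.End.one_apply]
      module
    · simp only [LinearMap.mem_ker, LinearMap.add_apply, map_smul, map_sub, hff,
        Module.End.one_apply]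
      module
    · module

/-- A representation of a group generated by commuting involutions is a sum of characters. -/
theorem cls_mem_closure (hcomm : ∀ i j, Commute (s i) (s j)) (hsq : ∀ i, s i * s i = 1)
    (hgen : Subgroup.closure (Set.range s) = ⊤) {χ : Set ι → H →* ℂ}
    (hχ : ∀ T i, (i ∈ T → χ T (s i) = -1) ∧ (i ∉ T → χ T (s i) = 1))
    (n : ℕ) (V : Type) [AddCommGroup V] [Module ℂ V]
    [FiniteDimensional ℂ V] (hn : Module.finrank ℂ V = n) (ρ : Representation ℂ H V) :
    cls ρ ∈ AddSubmonoid.closure (Set.range fun T => cls (scalarRep (χ T) ℂ)) := by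
  induction n using Nat.strong_induction_on generalizing V with
  | _ n ih =>
  -- If every involution acts by a sign, `ρ` is scalar. Otherwise some `s i` has two proper
  -- eigenspaces, which are subrepresentations because `s i` is central, and induction on the
  -- dimension applies to both.
  by_cases hs : ∀ i, ρ (s i) = 1 ∨ ρ (s i) = -1
  · let T : Set ι := {i | ρ (s i) ≠ 1}
    have : ρ = scalarRep (χ T) V := by
      refine MonoidHom.eq_of_eqOn_dense hgen ?_
      rintro _ ⟨i, rfl⟩
      ext v
      rw [scalarRep_apply]
      by_cases hi : i ∈ T
      · rw [(hχ T i).1 hi, (hs i).resolve_left hi]; simp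
      · rw [(hχ T i).2 hi, not_not.1 hi]; simp
    rw [this, cls_scalarRep (χ T) _ V rfl]
    exact nsmul_mem (AddSubmonoid.subset_closure (Set.mem_range_self T)) _
  · push Not at hs
    obtain ⟨i, h1, h2⟩ := hs
    have hc := isCompl_ker_of_mul_self_eq_one (ρ (s i)) (by rw [← map_mul, hsq, map_one])
    have hρ : ∀ h v, ρ (s i) (ρ h v) = ρ h (ρ (s i) v) := fun h v => by
      rw [← Module.End.mul_apply, ← Module.End.mul_apply, ← map_mul, ← map_mul,
        (commute_of_closure_eq_top hcomm hgen i h).eq]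
    let A : Subrepresentation ρ := ⟨LinearMap.ker (ρ (s i) - 1), fun h v hv => by
      simp only [LinearMap.mem_ker, LinearMap.sub_apply, Module.End.one_apply, hρ] at hv ⊢
      rw [← map_sub, hv, map_zero]⟩
    let B : Subrepresentation ρ := ⟨LinearMap.ker (ρ (s i) + 1), fun h v hv => by
      simp only [LinearMap.mem_ker, LinearMap.add_apply, Module.End.one_apply, hρ] at hv ⊢
      rw [← map_add, hv, map_zero]⟩
    have hA : Module.finrank ℂ A.toSubmodule < n := hn ▸ Submodule.finrank_lt fun h =>
      h1 (sub_eq_zero.1 (LinearMap.ker_eq_top.1 h))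
    have hB : Module.finrank ℂ B.toSubmodule < n := hn ▸ Submodule.finrank_lt fun h =>
      h2 (eq_neg_of_add_eq_zero_left (LinearMap.ker_eq_top.1 h))
    have e : cls ρ = cls A.toRepresentation + cls B.toRepresentation := by
      rw [cls_add]
      refine Eq.symm ((cls_eq_iff _ _).2 ⟨Representation.Equiv.mk
        (Submodule.prodEquivOfIsCompl _ _ hc) fun h => ?_⟩)
      apply LinearMap.ext
      rintro ⟨a, b⟩
      exact (map_add (ρ h) (a : V) (b : V)).symm
    rw [e]
    exact add_mem (ih _ hA _ rfl _) (ih _ hB _ rfl _)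

-- The negative space lies in a line: it is everything if all `s i` with `i ∈ I` act by `-1`, and
-- zero as soon as one of them acts trivially.
open scoped Classical in
theorem negDim_scalarRep {χ : Set ι → H →* ℂ}
    (hχ : ∀ T i, (i ∈ T → χ T (s i) = -1) ∧ (i ∉ T → χ T (s i) = 1)) (I T : Set ι) :
    negDim (s '' I) (GrothendieckAddGroup.of (cls (scalarRep (χ T) ℂ)))
      = if I ⊆ T then 1 else 0 := by
  rw [negDim_of, negDimClass_cls]
  split_ifs with h
  · have : negSpace (scalarRep (χ T) ℂ) (s '' I) = ⊤ := by
      rw [eq_top_iff]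
      rintro v -
      rw [mem_negSpace]
      rintro _ ⟨i, hi, rfl⟩
      rw [scalarRep_apply, (hχ T i).1 (h hi), neg_one_smul]
    rw [this, finrank_top, Module.finrank_self, Nat.cast_one]
  · have : negSpace (scalarRep (χ T) ℂ) (s '' I) = ⊥ := by
      rw [eq_bot_iff]
      intro v hv
      obtain ⟨i, hi, hiT⟩ := Set.not_subset.1 h
      have := mem_negSpace.1 hv _ ⟨i, hi, rfl⟩
      rw [scalarRep_apply, (hχ T i).2 hiT, one_smul] at this
      exact self_eq_neg.1 this
    rw [this, finrank_bot, Nat.cast_zero]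

/-- For a group generated by finitely many commuting involutions that are separated by characters,
the dimensions of the negative spaces are coordinates on the representation ring. -/
theorem negDim_bijective [Finite ι] (hcomm : ∀ i j, Commute (s i) (s j))
    (hsq : ∀ i, s i * s i = 1) (hgen : Subgroup.closure (Set.range s) = ⊤) {χ : Set ι → H →* ℂ}
    (hχ : ∀ T i, (i ∈ T → χ T (s i) = -1) ∧ (i ∉ T → χ T (s i) = 1)) :
    Function.Bijective fun (x : RepRing H) (I : Set ι) => negDim (s '' I) x := by
  classical
  have := Fintype.ofFinite (Set ι)
  let κ : RepRing H →ₗ[ℤ] (Set ι → ℤ) :=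
    LinearMap.pi fun I => (negDim (s '' I)).toIntLinearMap
  let b : Set ι → RepRing H := fun T => GrothendieckAddGroup.of (cls (scalarRep (χ T) ℂ))
  have hκb : ∀ T, κ (b T) = fun I => if I ⊆ T then 1 else 0 := fun T =>
    funext fun I => negDim_scalarRep hχ I T
  -- Unitriangularity: `κ (b T)` is the indicator function of the subsets of `T`, so subtracting the
  -- unit vectors of the proper subsets leaves the unit vector of `T`.
  have hsingle : ∀ T : Set ι, Pi.single T 1 ∈ LinearMap.range κ := by
    intro T
    induction T using WellFoundedLT.induction with
    | _ T ih =>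
    have e : (Pi.single T 1 : Set ι → ℤ)
        = κ (b T) - ∑ I ∈ Finset.univ.filter (· < T), Pi.single I 1 := by
      rw [hκb]
      funext J
      simp only [Pi.single_apply, Pi.sub_apply, Finset.sum_apply, Finset.sum_ite_eq,
        Finset.mem_filter, Finset.mem_univ, true_and]
      rcases eq_or_ne J T with rfl | h
      · simp
      · have : J < T ↔ J ⊆ T := ⟨fun h => h.le, fun h' => lt_of_le_of_ne h' h⟩
        simp [h, this]
    rw [e]
    exact sub_mem ⟨_, rfl⟩ (sum_mem fun I hI => ih I (Finset.mem_filter.1 hI).2)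
  have hκ : Function.Surjective κ := by
    rw [← LinearMap.range_eq_top, eq_top_iff]
    intro f _
    rw [pi_eq_sum_univ' f]
    refine sum_mem fun I _ => Submodule.smul_mem _ _ ?_
    convert hsingle I using 1
  let B : (Set ι → ℤ) →ₗ[ℤ] RepRing H := Fintype.linearCombination ℤ b
  have hBb : ∀ T, b T ∈ LinearMap.range B := fun T => ⟨Pi.single T 1, by
    simp [B]⟩
  have hof : ∀ x : RepClass H, GrothendieckAddGroup.of x ∈ LinearMap.range B := by
    intro x
    induction x using ind_cls with | _ n ρ
    have h := cls_mem_closure hcomm hsq hgen hχ _ _ rfl ρ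
    generalize cls ρ = y at h
    induction h using AddSubmonoid.closure_induction with
    | mem x hx => obtain ⟨T, rfl⟩ := hx; exact hBb T
    | zero => rw [map_zero]; exact zero_mem _
    | add x y _ _ hx hy => rw [map_add]; exact add_mem hx hy
  -- The quotient map by the range of `B` vanishes on classes of representations, hence on the
  -- Grothendieck group.
  have hB : Function.Surjective B := by
    rw [← LinearMap.range_eq_top, ← Submodule.ker_mkQ (LinearMap.range B), LinearMap.ker_eq_top]
    have : (LinearMap.range B).mkQ.toAddMonoidHom = 0 := hom_ext fun x => by
      simpa using hof x
    exact LinearMap.ext fun x => DFunLike.congr_fun this x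
  -- A surjective endomorphism of a finitely generated module is injective. Since `B` is onto,
  -- injectivity of `κ ∘ₗ B` passes to `κ`; linear independence of the characters is never needed
  -- separately.
  have hinj : Function.Injective (κ ∘ₗ B) :=
    OrzechProperty.injective_of_surjective_endomorphism _ (hκ.comp hB)
  refine ⟨fun x y hxy => ?_, hκ⟩
  obtain ⟨m, rfl⟩ := hB x
  obtain ⟨n, rfl⟩ := hB y
  exact congrArg B (hinj hxy)

end Involutions

end RepRing

/-! ### Equivariant maps out of orbits -/

namespace OrbitCat

variable {G : Type u} [Group G]

/-- The equivariant map `G ⧸ H → X`, `g H ↦ g x`, for a point `x` fixed by `H`. -/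
def orbitMap {X : Type*} [MulAction G X] (H : Subgroup G) (x : X) (hx : ∀ g ∈ H, g • x = x) :
    (G ⧸ H) →[G] X where
  toFun := Quotient.lift (fun g => g • x) fun a b hab => by
    have := hx _ (QuotientGroup.leftRel_apply.1 hab)
    rw [mul_smul] at this
    exact (inv_smul_eq_iff.1 this).symm
  map_smul' g y := by
    induction y using Quotient.ind with | _ a
    exact mul_smul g a x

theorem orbitMap_mk {X : Type*} [MulAction G X] (H : Subgroup G) (x : X)
    (hx : ∀ g ∈ H, g • x = x) (g : G) : orbitMap H x hx (g : G ⧸ H) = g • x := rfl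

theorem hom_ext_one {X : Type*} [MulAction G X] {H : Subgroup G} {f f' : (G ⧸ H) →[G] X}
    (h : f ((1 : G) : G ⧸ H) = f' ((1 : G) : G ⧸ H)) : f = f' := by
  refine MulActionHom.ext fun y => ?_
  induction y using Quotient.ind with | _ a
  have : (Quotient.mk _ a : G ⧸ H) = a • ((1 : G) : G ⧸ H) := by
    rw [MulAction.Quotient.smul_coe, smul_eq_mul, mul_one]
  rw [this, map_smul, map_smul, h]

theorem smul_apply_one {X : Type*} [MulAction G X] {H : Subgroup G} (f : (G ⧸ H) →[G] X)
    {h : G} (hh : h ∈ H) : h • f ((1 : G) : G ⧸ H) = f ((1 : G) : G ⧸ H) := by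
  rw [← map_smul, MulAction.Quotient.smul_coe, smul_eq_mul, mul_one]
  congr 1
  rw [eq_comm, QuotientGroup.eq]
  simpa using hh

/-- The projection `G ⧸ H → G ⧸ K` for `H ≤ K`. -/
def proj {X Y : OrbitCat G} (h : X.H ≤ Y.H) : X ⟶ Y :=
  orbitMap X.H ((1 : G) : G ⧸ Y.H) fun g hg => by
    rw [MulAction.Quotient.smul_coe, smul_eq_mul, mul_one, eq_comm, QuotientGroup.eq]
    simpa using h hg

/-- The representative `rep (proj h)` need not be `1`, but it lies in `Y.H`, and conjugation by an
element of `Y.H` does not affect restriction of classes. -/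
theorem map_proj {X Y : OrbitCat G} (h : X.H ≤ Y.H) (x : RepRing Y.H) :
    ((repRingFunctor G).map (proj h).op).hom x = RepRing.res (Subgroup.inclusion h) x := by
  have hm : rep (proj h) ∈ Y.H := by
    have h1 : ((rep (proj h) : G) : G ⧸ Y.H) = ((1 : G) : G ⧸ Y.H) :=
      (mk_rep (proj h)).trans (one_smul G ((1 : G) : G ⧸ Y.H))
    rw [eq_comm, QuotientGroup.eq] at h1
    simpa using h1
  change RepRing.res (conjHom (proj h)) x = _
  exact DFunLike.congr_fun (RepRing.res_conj _ _ ⟨_, hm⟩ fun x => by ext; rfl) x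

end OrbitCat

/-! ### Bredon cochains on a system of orbit representatives -/

namespace Bredon

open OrbitCat Opposite

variable {G : Type u} [Group G] {P : Type u} [PartialOrder P] [MulAction G P]
  [CovariantClass G P (· • ·) (· ≤ ·)] {M : (OrbitCat G)ᵒᵖ ⥤ ModuleCat.{u} ℤ} {n : ℕ}

/-- The basis element of `Cₙ(|P|ᴴ)` given by a cell. -/
def cellBasis (X : OrbitCat G) (c : (G ⧸ X.H) →[G] Chain P n) : (cells G P n).obj (op X) :=
  (Finsupp.single c 1 : ((G ⧸ X.H) →[G] Chain P n) →₀ ℤ)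

theorem map_cellBasis {X Y : OrbitCat G} (f : Y ⟶ X) (c : (G ⧸ X.H) →[G] Chain P n) :
    ((cells G P n).map f.op).hom (cellBasis X c) = cellBasis Y (c.comp (toHom f)) :=
  Finsupp.mapDomain_single

theorem cellFace_cellBasis (X : OrbitCat G) (c : (G ⧸ X.H) →[G] Chain P (n + 1))
    (i : Fin (n + 2)) : ((cellFace G P i).app (op X)).hom (cellBasis X c)
      = cellBasis X ((Chain.faceHom G P i).comp c) :=
  Finsupp.mapDomain_single

theorem cells_hom_ext {X : OrbitCat G} {A : ModuleCat.{u} ℤ} {f g : (cells G P n).obj (op X) ⟶ A}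
    (h : ∀ c, f.hom (cellBasis X c) = g.hom (cellBasis X c)) : f = g :=
  ModuleCat.hom_ext (Finsupp.lhom_ext' fun c => LinearMap.ext_ring (h c))

/-- The homomorphism on `Cₙ(|P|ᴴ)` with given values on the cells. -/
def cellsLift {X : OrbitCat G} {A : ModuleCat.{u} ℤ} (F : ((G ⧸ X.H) →[G] Chain P n) → A) :
    (cells G P n).obj (op X) ⟶ A :=
  ModuleCat.ofHom (Finsupp.linearCombination ℤ F)

theorem cellsLift_cellBasis {X : OrbitCat G} {A : ModuleCat.{u} ℤ}
    (F : ((G ⧸ X.H) →[G] Chain P n) → A) (c : (G ⧸ X.H) →[G] Chain P n) :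
    (cellsLift F).hom (cellBasis X c) = F c :=
  (Finsupp.linearCombination_single ℤ 1 c).trans (A.isModule.one_smul _)

/-- The value of a natural transformation `Cₙ(|P|⁻) → M` on an `H`-fixed cell. -/
def evalCell (φ : cells G P n ⟶ M) (X : OrbitCat G) (c : Chain P n) (hc : ∀ g ∈ X.H, g • c = c) :
    M.obj (op X) :=
  (φ.app (op X)).hom (cellBasis X (orbitMap X.H c hc))

theorem app_cellBasis_comp (φ : cells G P n ⟶ M) {X Y : OrbitCat G} (f : Y ⟶ X)
    (c : (G ⧸ X.H) →[G] Chain P n) :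
    (φ.app (op Y)).hom (cellBasis Y (c.comp (toHom f)))
      = (M.map f.op).hom ((φ.app (op X)).hom (cellBasis X c)) := by
  rw [← map_cellBasis]
  exact ConcreteCategory.congr_hom (φ.naturality f.op) (cellBasis X c)

theorem boundary_app_apply (X : (OrbitCat G)ᵒᵖ) (y : (cells G P (n + 1)).obj X) :
    ((boundary G P n).app X).hom y
      = ∑ i : Fin (n + 2), (-1 : ℤ) ^ (i : ℕ) • ((cellFace G P i).app X).hom y := by
  simp only [boundary, NatTrans.app_sum, NatTrans.app_zsmul, ModuleCat.hom_sum,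
    ModuleCat.hom_zsmul, LinearMap.sum_apply]
  rfl

theorem evalCell_eq_map (φ : cells G P n ⟶ M) {X Y : OrbitCat G} (h : Y.H ≤ X.H) (c : Chain P n)
    (hc : ∀ g ∈ X.H, g • c = c) :
    evalCell φ Y c (fun g hg => hc g (h hg)) = (M.map (proj h).op).hom (evalCell φ X c hc) := by
  rw [evalCell, evalCell, ← app_cellBasis_comp]
  congr 2
  apply hom_ext_one
  change (1 : G) • c = orbitMap X.H c hc ((1 : G) • ((1 : G) : G ⧸ X.H))
  rw [one_smul, one_smul, orbitMap_mk, one_smul]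

theorem evalCell_boundary (φ : cells G P n ⟶ M) (X : OrbitCat G) (c : Chain P (n + 1))
    (hc : ∀ g ∈ X.H, g • c = c) :
    evalCell (boundary G P n ≫ φ) X c hc = ∑ i : Fin (n + 2), (-1 : ℤ) ^ (i : ℕ) •
      evalCell φ X (c.face i) (fun g hg => congrArg (Chain.face i) (hc g hg)) := by
  change (φ.app (op X)).hom (((boundary G P n).app (op X)).hom _) = _
  rw [boundary_app_apply, map_sum]
  refine Finset.sum_congr rfl fun i _ => ?_
  rw [map_zsmul, cellFace_cellBasis]
  congr 3
  exact hom_ext_one rfl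

/-- A system of representatives `x` for the orbits of `G` on the `n`-cells, with isotropy
groups `X`. -/
structure IsFundamental {D : Type*} (x : D → Chain P n) (X : D → OrbitCat G) : Prop where
  smul_eq_iff : ∀ d g, g • x d = x d ↔ g ∈ (X d).H
  exists_smul_eq : ∀ c, ∃ d, ∃ g : G, g • x d = c
  eq_of_smul_eq : ∀ d d' (g : G), g • x d = x d' → d = d'

namespace IsFundamental

variable {D : Type*} {x : D → Chain P n} {X : D → OrbitCat G} (hx : IsFundamental x X)

/-- Together with the uniqueness in `map_eq_map`, this exhibits the presheaf of cells as a disjoint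
union of representables, one for each representative `x d`. -/
theorem exists_comp_eq (Y : OrbitCat G) (c : (G ⧸ Y.H) →[G] Chain P n) :
    ∃ d, ∃ f : Y ⟶ X d,
      (orbitMap (X d).H (x d) fun g hg => (hx.smul_eq_iff d g).2 hg).comp (toHom f) = c := by
  obtain ⟨d, a, h⟩ := hx.exists_smul_eq (c ((1 : G) : G ⧸ Y.H))
  -- The coset of `a` is fixed by `g` because `a⁻¹ * g * a` fixes `x d`.
  refine ⟨d, orbitMap Y.H ((a : G) : G ⧸ (X d).H) fun g hg => ?_, hom_ext_one ?_⟩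
  · rw [MulAction.Quotient.smul_coe, smul_eq_mul, eq_comm, QuotientGroup.eq, ← hx.smul_eq_iff,
      mul_smul, mul_smul, h, smul_apply_one c hg, ← h, inv_smul_smul]
  · refine Eq.trans ?_ h
    change orbitMap (X d).H (x d) (fun g hg => (hx.smul_eq_iff d g).2 hg)
      ((1 : G) • ((a : G) : G ⧸ (X d).H)) = _
    rw [one_smul]
    rfl

/-- In fact `d = d'` and `f = f'`. The conclusion compares values of `M` because `f` and `f'` have
different types until `d = d'` is known. -/
theorem map_eq_map {Y : OrbitCat G} {d d' : D} {f : Y ⟶ X d} {f' : Y ⟶ X d'}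
    (h : (orbitMap (X d).H (x d) fun g hg => (hx.smul_eq_iff d g).2 hg).comp (toHom f) =
      (orbitMap (X d').H (x d') fun g hg => (hx.smul_eq_iff d' g).2 hg).comp (toHom f'))
    (a : ∀ d, M.obj (op (X d))) : (M.map f.op).hom (a d) = (M.map f'.op).hom (a d') := by
  have h1 : rep f • x d = rep f' • x d' := by
    have := DFunLike.congr_fun h ((1 : G) : G ⧸ Y.H)
    rwa [MulActionHom.comp_apply, MulActionHom.comp_apply, ← mk_rep, ← mk_rep] at this
  obtain rfl : d = d' := hx.eq_of_smul_eq d d' ((rep f')⁻¹ * rep f) (by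
    rw [mul_smul, h1, inv_smul_smul])
  have : f = f' := by
    refine hom_ext_one ?_
    change toHom f _ = toHom f' _
    rw [← mk_rep, ← mk_rep, eq_comm, QuotientGroup.eq, ← hx.smul_eq_iff, mul_smul, h1,
      inv_smul_smul]
  rw [this]

theorem hom_ext {φ ψ : cells G P n ⟶ M}
    (h : ∀ d, evalCell φ (X d) (x d) (fun g hg => (hx.smul_eq_iff d g).2 hg) =
      evalCell ψ (X d) (x d) fun g hg => (hx.smul_eq_iff d g).2 hg) : φ = ψ := by
  ext Y : 2
  refine cells_hom_ext fun c => ?_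
  obtain ⟨d, f, rfl⟩ := hx.exists_comp_eq Y.unop c
  exact (app_cellBasis_comp φ f _).trans
    ((congrArg _ (h d)).trans (app_cellBasis_comp ψ f _).symm)

/-- Existence half of Yoneda for a union of representables. The chosen factorizations of cells need
not be compatible; `map_eq_map` makes the values independent of them, which gives both naturality
and the prescribed values. -/
theorem exists_hom (a : ∀ d, M.obj (op (X d))) : ∃ φ : cells G P n ⟶ M, ∀ d,
    evalCell φ (X d) (x d) (fun g hg => (hx.smul_eq_iff d g).2 hg) = a d := by
  choose δ f hf using hx.exists_comp_eq
  let F (Y : OrbitCat G) (c : (G ⧸ Y.H) →[G] Chain P n) : M.obj (op Y) :=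
    (M.map (f Y c).op).hom (a (δ Y c))
  refine ⟨{ app := fun Y => cellsLift (F Y.unop), naturality := fun Y Z g => ?_ }, fun d => ?_⟩
  · refine cells_hom_ext (X := Y.unop) fun c => ?_
    change (cellsLift (F Z.unop)).hom (((cells G P n).map g.unop.op).hom (cellBasis Y.unop c)) =
      (M.map g).hom ((cellsLift (F Y.unop)).hom (cellBasis Y.unop c))
    rw [map_cellBasis, cellsLift_cellBasis, cellsLift_cellBasis]
    have h1 : (M.map g).hom (F Y.unop c)
        = (M.map (g.unop ≫ f Y.unop c).op).hom (a (δ Y.unop c)) := by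
      rw [op_comp, M.map_comp]; rfl
    rw [h1]
    refine hx.map_eq_map ?_ a
    rw [hf]
    exact congrArg (fun e => MulActionHom.comp e (toHom g.unop)) (hf Y.unop c).symm
  · refine (cellsLift_cellBasis _ _).trans ?_
    refine (hx.map_eq_map (f' := 𝟙 (X d)) ?_ a).trans ?_
    · rw [hf]; rfl
    · rw [op_id, M.map_id]; rfl

end IsFundamental

end Bredon

/-! ### The cone contraction for chains above a given element -/

namespace Chain

variable {Q : Type u} [PartialOrder Q] {n : ℕ}

/-- Extend a chain by a smaller element. -/
def cons (q : Q) (c : Chain Q n) (h : q < c.vert 0) : Chain Q (n + 1) :=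
  ⟨Fin.cons q c.vert, by
    rw [Fin.strictMono_iff_lt_succ]
    intro i
    induction i using Fin.cases with
    | zero => simpa using h
    | succ i =>
      rw [← Fin.succ_castSucc, Fin.cons_succ, Fin.cons_succ]
      exact c.strictMono i.castSucc_lt_succ⟩

theorem face_zero_cons (q : Q) (c : Chain Q n) (h : q < c.vert 0) : (cons q c h).face 0 = c := by
  ext i
  simp [face, cons]

theorem vert_zero_le_face (c : Chain Q (n + 1)) (i : Fin (n + 2)) :
    c.vert 0 ≤ (c.face i).vert 0 :=
  c.strictMono.monotone (Fin.zero_le _)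

theorem face_succ_vert_zero (c : Chain Q (n + 1)) (i : Fin (n + 1)) :
    (c.face i.succ).vert 0 = c.vert 0 := by
  simp [face]

theorem face_succ_cons (q : Q) (c : Chain Q (n + 1)) (h : q < c.vert 0) (i : Fin (n + 2)) :
    (cons q c h).face i.succ = cons q (c.face i) (h.trans_le (c.vert_zero_le_face i)) := by
  ext j
  induction j using Fin.cases with
  | zero => simp [face, cons]
  | succ j => simp [face, cons]

/-- The one-element chain. -/
def single (q : Q) : Chain Q 0 :=
  ⟨fun _ => q, fun i j h => absurd h (Subsingleton.elim (α := Fin 1) i j).not_lt⟩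

theorem eq_single (c : Chain Q 0) : c = single (c.vert 0) :=
  Chain.ext' fun i => congrArg c.vert (Subsingleton.elim (α := Fin 1) i 0)

open scoped Classical in
/-- The contraction of the cochains on the chains above `q`, by prepending `q`. -/
def contract (q : Q) (f : Chain Q (n + 1) → ℤ) (c : Chain Q n) : ℤ :=
  if h : q < c.vert 0 then f (cons q c h) else 0

/-- The chains above `q` form a cone with apex `q`, and prepending `q` is the contracting homotopy.
If `q` lies strictly below `c`, the cocycle condition on `q < c` is the claim. -/
theorem sum_contract_face (q : Q) (f : Chain Q (n + 1) → ℤ)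
    (hf : ∀ c : Chain Q (n + 2), q ≤ c.vert 0 → ∑ i : Fin (n + 3), (-1 : ℤ) ^ (i : ℕ) *
      f (c.face i) = 0) (c : Chain Q (n + 1)) (hc : q ≤ c.vert 0) :
    ∑ i : Fin (n + 2), (-1 : ℤ) ^ (i : ℕ) * contract q f (c.face i) = f c := by
  rcases hc.lt_or_eq with h | h
  · have := hf (cons q c h) le_rfl
    rw [Fin.sum_univ_succ, face_zero_cons] at this
    have e : ∀ i : Fin (n + 2), (-1 : ℤ) ^ (i.succ : ℕ) * f ((cons q c h).face i.succ)
        = - ((-1 : ℤ) ^ (i : ℕ) * contract q f (c.face i)) := fun i => by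
      rw [face_succ_cons, contract, dif_pos (h.trans_le (c.vert_zero_le_face i)), Fin.val_succ,
        pow_succ]
      ring
    simp only [e, Finset.sum_neg_distrib, Fin.val_zero, pow_zero, one_mul] at this
    linarith
  -- If `c` already starts at `q`, only the face omitting `q` contributes, and prepending `q` to it
  -- returns `c`. The other faces start at `q`, where `contract` takes its default value `0`.
  · have h0 : q < (c.face 0).vert 0 := by
      rw [h]
      exact c.strictMono Fin.zero_lt_one
    rw [Fin.sum_univ_succ, Finset.sum_eq_zero, contract, dif_pos h0]
    · simp only [Fin.val_zero, pow_zero, one_mul, add_zero]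
      congr 1
      ext i
      induction i using Fin.cases with
      | zero => exact h
      | succ i => simp [face, cons]
    · intro i _
      rw [contract, dif_neg, mul_zero]
      rw [face_succ_vert_zero, h]
      exact lt_irrefl _

end Chain

/-! ### The fundamental domain of the Davis complex and the rings `R(W_J)` -/

namespace RACG

open scoped Pointwise

variable {V : Type u} (Γ : SimpleGraph V)

/-- The poset of spherical subsets. -/
abbrev SphericalSet : Type u := {J : Set V // IsSpherical Γ J}

variable {Γ}

/-- The coset `W_J`. -/
def stdCoset (J : SphericalSet Γ) : SphericalCoset Γ :=
  ⟨parabolic Γ J.1, 1, J.1, J.2, (one_smul _ _).symm⟩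

theorem stdCoset_lt_iff {I J : SphericalSet Γ} : stdCoset I < stdCoset J ↔ I < J :=
  lt_iff_lt_of_le_iff_le' (parabolic_le_iff Γ) (parabolic_le_iff Γ)

theorem smul_stdCoset_eq_iff {J : SphericalSet Γ} {g : W Γ} :
    g • stdCoset J = stdCoset J ↔ g ∈ parabolic Γ J.1 := by
  refine Subtype.ext_iff.trans ?_
  change g • (parabolic Γ J.1 : Set (W Γ)) = parabolic Γ J.1 ↔ _
  refine ⟨fun h => ?_, smul_coe_set⟩
  have : g • (1 : W Γ) ∈ g • (parabolic Γ J.1 : Set (W Γ)) :=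
    Set.smul_mem_smul_set (one_mem _)
  rw [h] at this
  simpa using this

/-- The identity of `W_I` shows `g ∈ W_J`, so `g W_I = W_J = g W_J`, and `g` cancels. -/
theorem eq_of_smul_stdCoset_eq {I J : SphericalSet Γ} {g : W Γ}
    (h : g • stdCoset I = stdCoset J) : I = J := by
  have h' : g • (parabolic Γ I.1 : Set (W Γ)) = parabolic Γ J.1 := congrArg Subtype.val h
  have hg : g ∈ parabolic Γ J.1 := by
    have : g • (1 : W Γ) ∈ g • (parabolic Γ I.1 : Set (W Γ)) :=
      Set.smul_mem_smul_set (one_mem _)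
    rw [h'] at this
    simpa using this
  rw [← smul_coe_set hg] at h'
  exact Subtype.ext (parabolic_injective Γ (SetLike.coe_injective (smul_left_cancel g h')))

/-- Any element of a coset represents it. Hence one element of the smallest coset of a chain moves
standard cosets to all of its vertices simultaneously. -/
theorem exists_smul_stdCoset_eq {A : SphericalCoset Γ} {w : W Γ} (hw : w ∈ A.1) :
    ∃ J, w • stdCoset J = A := by
  obtain ⟨_, v, J, hJ, rfl⟩ := A
  refine ⟨⟨J, hJ⟩, Subtype.ext ?_⟩
  change w • (parabolic Γ J : Set (W Γ)) = v • _
  obtain ⟨x, hx, rfl⟩ := hw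
  change (v • x) • _ = _
  rw [smul_eq_mul, mul_smul, smul_coe_set hx]

/-- The chain `W_{J₀} < ⋯ < W_{Jₙ}`. -/
def stdChain {n : ℕ} (c : Chain (SphericalSet Γ) n) : Chain (SphericalCoset Γ) n :=
  ⟨fun i => stdCoset (c.vert i), fun _ _ h => stdCoset_lt_iff.2 (c.strictMono h)⟩

/-- The orbit `W ⧸ W_J`. -/
def sphericalOrbit (J : SphericalSet Γ) : OrbitCat (W Γ) := ⟨parabolic Γ J.1, J.2⟩

/-- The chains of spherical subsets form a strict fundamental domain of the Davis complex. -/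
theorem isFundamental_stdChain (n : ℕ) : Bredon.IsFundamental
    (stdChain (Γ := Γ) (n := n)) (fun c => sphericalOrbit (c.vert 0)) where
  smul_eq_iff c g := by
    refine ⟨fun h => smul_stdCoset_eq_iff.1 (congrArg (fun d => d.vert 0) h),
      fun h => Chain.ext' fun i => smul_stdCoset_eq_iff.2 ?_⟩
    exact (parabolic_le_iff Γ).2 (c.strictMono.monotone (Fin.zero_le i)) h
  exists_smul_eq c := by
    have h0 : ∃ w, w ∈ (c.vert 0).1 := by
      obtain ⟨w, J, hJ, h⟩ := (c.vert 0).2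
      exact ⟨w • 1, h ▸ Set.smul_mem_smul_set (one_mem _)⟩
    obtain ⟨w, hw⟩ := h0
    have hi : ∀ i, ∃ J, w • stdCoset J = c.vert i := fun i =>
      exists_smul_stdCoset_eq (c.strictMono.monotone (Fin.zero_le i) hw)
    choose J hJ using hi
    refine ⟨⟨J, fun i j hij => ?_⟩, w, Chain.ext' hJ⟩
    have h1 : w⁻¹ • c.vert i ≤ w⁻¹ • c.vert j :=
      CovariantClass.elim w⁻¹ (c.strictMono hij).le
    rw [← hJ, ← hJ, inv_smul_smul, inv_smul_smul] at h1
    refine lt_of_le_of_ne ((parabolic_le_iff Γ).1 h1) fun h => (c.strictMono hij).ne ?_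
    rw [← hJ i, ← hJ j, h]
  eq_of_smul_eq c d g h := Chain.ext' fun i =>
    eq_of_smul_stdCoset_eq (congrArg (fun d => d.vert i) h)

/-- The generators of `W` in a spherical subset `I`, as elements of a subgroup. -/
def simplesIn (I : SphericalSet Γ) (H : Subgroup (W Γ)) : Set H :=
  Subtype.val ⁻¹' ((coxeterMatrix Γ).simple '' I.1)

/-- The dimensions of the negative spaces are coordinates on `R(W_J)`. -/
theorem negDim_simplesIn_bijective [Finite V] (J : SphericalSet Γ) :
    Function.Bijective fun (x : RepRing (parabolic Γ J.1)) (I : Set.Iic J) =>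
      RepRing.negDim (simplesIn I.1 (parabolic Γ J.1)) x := by
  let s : J.1 → parabolic Γ J.1 := fun j =>
    ⟨(coxeterMatrix Γ).simple j.1, (simple_mem_parabolic_iff Γ).2 j.2⟩
  -- The characters of `W_J` are restrictions of sign characters of `W`, which are defined by the
  -- presentation.
  have hb := RepRing.negDim_bijective (s := s)
    (χ := fun T => (signChar Γ (Subtype.val '' T)).comp (parabolic Γ J.1).subtype)
    (fun i j => Subtype.ext (J.2.commute_simple i.2 j.2))
    (fun i => Subtype.ext (simple_mul_self Γ i.1)) (by
      refine Eq.trans (congrArg _ ?_) (Subgroup.closure_closure_coe_preimage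
        (k := (coxeterMatrix Γ).simple '' J.1))
      ext x
      exact ⟨fun ⟨j, hj⟩ => ⟨j, j.2, congrArg Subtype.val hj⟩,
        fun ⟨v, hv, h⟩ => ⟨⟨v, hv⟩, Subtype.ext h⟩⟩)
    (fun T i => ⟨fun h => by simp [s, signChar_simple, h],
      fun h => by simp [s, signChar_simple, h]⟩)
  let e : Set J.1 ≃ Set.Iic J :=
    { toFun T := ⟨⟨Subtype.val '' T, J.2.mono (Subtype.coe_image_subset _ _)⟩,
        Subtype.coe_image_subset _ _⟩
      invFun I := Subtype.val ⁻¹' I.1.1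
      left_inv T := Set.preimage_image_eq _ Subtype.val_injective
      right_inv I := by
        ext x
        simp only [Subtype.image_preimage_coe, Set.mem_inter_iff, and_iff_right_iff_imp]
        exact fun h => I.2 h }
  have hs : ∀ T, s '' T = simplesIn (e T).1 (parabolic Γ J.1) := by
    intro T
    ext x
    simp [s, e, simplesIn, Subtype.ext_iff]
  have := ((Equiv.arrowCongr e (Equiv.refl ℤ)).bijective).comp hb
  convert this using 1
  funext x I
  simp [hs]

end RACG

/-! ### Splitting of the Bredon complex and its cohomology -/

namespace RACG

open Bredon Opposite

variable {V : Type u} {Γ : SimpleGraph V} {n : ℕ}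

/-- Since `I ≤ J`, the generators in `I` already lie in `W_J`, so the same operators are tested
before and after restriction. -/
theorem negDim_map_proj {J K : SphericalSet Γ} (I : SphericalSet Γ) (hIJ : I ≤ J)
    (h : (sphericalOrbit J).H ≤ (sphericalOrbit K).H) (x : RepRing (parabolic Γ K.1)) :
    RepRing.negDim (simplesIn I (parabolic Γ J.1))
        (((repRingFunctor (W Γ)).map (OrbitCat.proj h).op).hom x)
      = RepRing.negDim (simplesIn I (parabolic Γ K.1)) x := by
  refine (congrArg _ (OrbitCat.map_proj h x)).trans ?_
  refine (RepRing.negDim_res _ _ x).trans ?_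
  congr 2
  ext y
  constructor
  · rintro ⟨z, hz, rfl⟩
    exact hz
  · rintro ⟨s, hs, hy⟩
    exact ⟨⟨y.1, hy ▸ (simple_mem_parabolic_iff Γ).2 (hIJ hs)⟩, ⟨s, hs, hy⟩, rfl⟩

theorem smul_stdChain (c : Chain (SphericalSet Γ) n) (g : W Γ)
    (hg : g ∈ (sphericalOrbit (c.vert 0)).H) : g • stdChain c = stdChain c :=
  ((isFundamental_stdChain n).smul_eq_iff c g).2 hg

/-- The coordinates of a Bredon cochain of the Davis complex: the dimension of the negative space
of the generators in `I` in its value on the chain `W_{J₀} < ⋯ < W_{Jₙ}`. -/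
def coord (I : SphericalSet Γ) (c : Chain (SphericalSet Γ) n) :
    (cells (W Γ) (SphericalCoset Γ) n ⟶ repRingFunctor (W Γ)) →+ ℤ where
  toFun φ := RepRing.negDim (simplesIn I (parabolic Γ (c.vert 0).1))
    (evalCell φ (sphericalOrbit (c.vert 0)) (stdChain c) (smul_stdChain c))
  map_zero' := map_zero (RepRing.negDim (simplesIn I (parabolic Γ (c.vert 0).1)))
  map_add' φ ψ := map_add (RepRing.negDim (simplesIn I (parabolic Γ (c.vert 0).1)))
    (evalCell φ (sphericalOrbit (c.vert 0)) (stdChain c) (smul_stdChain c))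
    (evalCell ψ (sphericalOrbit (c.vert 0)) (stdChain c) (smul_stdChain c))

/-- The face omitting the first vertex has larger isotropy, so its value enters through a
restriction, which does not change the coordinate `I`. What remains is the untwisted simplicial
coboundary on the chains above `I`. -/
theorem coord_boundary (φ : cells (W Γ) (SphericalCoset Γ) n ⟶ repRingFunctor (W Γ))
    (I : SphericalSet Γ) (c : Chain (SphericalSet Γ) (n + 1)) (hI : I ≤ c.vert 0) :
    coord I c (boundary _ _ n ≫ φ)
      = ∑ i : Fin (n + 2), (-1 : ℤ) ^ (i : ℕ) * coord I (c.face i) φ := by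
  have h := congrArg (RepRing.negDim (simplesIn I (parabolic Γ (c.vert 0).1)))
    (evalCell_boundary φ (sphericalOrbit (c.vert 0)) (stdChain c) (smul_stdChain c))
  refine h.trans ?_
  refine (map_sum _ _ _).trans (Finset.sum_congr rfl fun i _ => ?_)
  refine (map_zsmul _ _ _).trans ?_
  rw [smul_eq_mul]
  congr 1
  have hle : (sphericalOrbit (c.vert 0)).H ≤ (sphericalOrbit ((c.face i).vert 0)).H :=
    (parabolic_le_iff Γ).2 (c.vert_zero_le_face i)
  exact (congrArg _ (evalCell_eq_map φ hle (stdChain (c.face i)) (smul_stdChain (c.face i)))).trans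
    (negDim_map_proj I hI hle _)

theorem cochainComplex_d_apply (φ : cells (W Γ) (SphericalCoset Γ) n ⟶ repRingFunctor (W Γ)) :
    ((cochainComplex (W Γ) (SphericalCoset Γ) (repRingFunctor (W Γ))).d n (n + 1)).hom φ
      = boundary _ _ n ≫ φ := by
  change (chainComplex (W Γ) (SphericalCoset Γ)).d (n + 1) n ≫ φ = _
  congr 1
  exact ChainComplex.of_d (cells (W Γ) (SphericalCoset Γ)) (boundary _ _) n

variable (Γ) in
theorem card_sphericalSubgroups :
    Nat.card (sphericalSubgroups Γ) = Nat.card (SphericalSet Γ) := by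
  refine (Nat.card_congr (Equiv.ofBijective
    (fun J : SphericalSet Γ => (⟨parabolic Γ J.1, J.1, J.2, rfl⟩ : sphericalSubgroups Γ))
    ⟨fun I J h => Subtype.ext (parabolic_injective Γ (congrArg Subtype.val h)), ?_⟩)).symm
  rintro ⟨_, J, hJ, rfl⟩
  exact ⟨⟨J, hJ⟩, rfl⟩

/-- For `I < J` this is the cocycle condition on the edge `W_I < W_J`: every vertex above `I` is
joined to the apex. -/
theorem coord_single_eq {φ : cells (W Γ) (SphericalCoset Γ) 0 ⟶ repRingFunctor (W Γ)}
    (hφ : boundary _ _ 0 ≫ φ = 0) {I J : SphericalSet Γ} (h : I ≤ J) :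
    coord I (Chain.single J) φ = coord I (Chain.single I) φ := by
  rcases h.lt_or_eq with h | rfl
  · have h' : I < (Chain.single J).vert 0 := h
    have := coord_boundary φ I (Chain.cons I (Chain.single J) h') le_rfl
    rw [hφ, map_zero, Fin.sum_univ_two, Chain.face_zero_cons,
      Chain.eq_single (Chain.face 1 _)] at this
    change 0 = _ + (-1 : ℤ) ^ 1 * coord I (Chain.single I) φ at this
    simp only [Fin.val_zero, pow_zero, pow_one] at this
    linarith
  · rfl

variable [Finite V]

theorem hom_ext_coord {φ ψ : cells (W Γ) (SphericalCoset Γ) n ⟶ repRingFunctor (W Γ)}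
    (h : ∀ (c : Chain (SphericalSet Γ) n) (I : SphericalSet Γ), I ≤ c.vert 0 →
      coord I c φ = coord I c ψ) : φ = ψ :=
  (isFundamental_stdChain n).hom_ext fun c =>
    (negDim_simplesIn_bijective (c.vert 0)).1 (funext fun I => h c I.1 I.2)

/-- With `hom_ext_coord`, cochains become arbitrary integer functions on the pairs with `I ≤ c.vert
0`; the values of `f` at other pairs play no role. -/
theorem exists_hom_coord (f : SphericalSet Γ → Chain (SphericalSet Γ) n → ℤ) :
    ∃ φ : cells (W Γ) (SphericalCoset Γ) n ⟶ repRingFunctor (W Γ),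
      ∀ (c : Chain (SphericalSet Γ) n) (I : SphericalSet Γ), I ≤ c.vert 0 →
        coord I c φ = f I c := by
  choose a ha using fun c : Chain (SphericalSet Γ) n =>
    (negDim_simplesIn_bijective (c.vert 0)).2 fun I => f I.1 c
  obtain ⟨φ, hφ⟩ := (isFundamental_stdChain n).exists_hom (M := repRingFunctor (W Γ)) a
  refine ⟨φ, fun c I hI => ?_⟩
  exact (congrArg _ (hφ c)).trans (congrFun (ha c) ⟨I, hI⟩)

/-- The contraction with apex `I` is applied to the coordinate `I`, for each `I` separately; the
results assemble into one cochain because coordinates can be prescribed freely. -/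
theorem exists_boundary_comp_eq
    (φ : cells (W Γ) (SphericalCoset Γ) (n + 1) ⟶ repRingFunctor (W Γ))
    (hφ : boundary _ _ (n + 1) ≫ φ = 0) : ∃ ψ, boundary _ _ n ≫ ψ = φ := by
  obtain ⟨ψ, hψ⟩ := exists_hom_coord fun I c => Chain.contract I (fun d => coord I d φ) c
  refine ⟨ψ, hom_ext_coord fun c I hI => ?_⟩
  rw [coord_boundary ψ I c hI, ← Chain.sum_contract_face I (fun d => coord I d φ) _ c hI]
  · exact Finset.sum_congr rfl fun i _ => by rw [hψ _ _ (hI.trans (c.vert_zero_le_face i))]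
  · intro d hd
    rw [← coord_boundary φ I d hd, hφ, map_zero]

/-- The degree `0` cocycles are determined by the coordinates `I` of their values on `W_I`. -/
theorem bijective_coord_single : Function.Bijective
    fun (φ : {φ : cells (W Γ) (SphericalCoset Γ) 0 ⟶ repRingFunctor (W Γ) //
      boundary _ _ 0 ≫ φ = 0}) (I : SphericalSet Γ) => coord I (Chain.single I) φ.1 := by
  constructor
  · rintro ⟨φ, hφ⟩ ⟨ψ, hψ⟩ h
    refine Subtype.ext (hom_ext_coord fun c I hI => ?_)
    rw [Chain.eq_single c, coord_single_eq hφ hI, coord_single_eq hψ hI]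
    exact congrFun h I
  · intro f
    -- The coordinate `I` is made constant on all vertices above `I`, so its two contributions to
    -- the coboundary on an edge cancel.
    obtain ⟨φ, hφ⟩ := exists_hom_coord (n := 0) fun I (_ : Chain (SphericalSet Γ) 0) => f I
    refine ⟨⟨φ, hom_ext_coord fun c I hI => ?_⟩, funext fun I => hφ _ _ le_rfl⟩
    rw [coord_boundary φ I c hI, Fin.sum_univ_two, hφ _ _ (hI.trans (c.vert_zero_le_face 0)),
      hφ _ _ (hI.trans (c.vert_zero_le_face 1)), map_zero]
    simp

variable (Γ)

theorem subsingleton_davisCohomology_succ (n : ℕ) :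
    Subsingleton (davisCohomology Γ (n + 1)) := by
  refine ModuleCat.subsingleton_of_isZero (HomologicalComplex.ExactAt.isZero_homology ?_)
  rw [HomologicalComplex.exactAt_iff' _ n (n + 1) (n + 2) (by simp) (by simp),
    ShortComplex.moduleCat_exact_iff]
  intro φ hφ
  obtain ⟨ψ, hψ⟩ := exists_boundary_comp_eq φ ((cochainComplex_d_apply φ).symm.trans hφ)
  exact ⟨ψ, (cochainComplex_d_apply ψ).trans hψ⟩

/-- The degree `0` Bredon cohomology of the Davis complex. -/
theorem nonempty_davisCohomology_zero_equiv :
    Nonempty (davisCohomology Γ 0 ≃ₗ[ℤ] (SphericalSet Γ → ℤ)) := by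
  let K := cochainComplex (W Γ) (SphericalCoset Γ) (repRingFunctor (W Γ))
  have e : davisCohomology Γ 0 ≃ₗ[ℤ] LinearMap.ker (K.d 0 1).hom :=
    (K.isoHomologyπ₀.symm ≪≫ K.cyclesIsoSc' 0 0 1 (by simp) (by simp) ≪≫
      (K.sc' 0 0 1).moduleCatCyclesIso).toLinearEquiv
  let f : LinearMap.ker (K.d 0 1).hom →+ (SphericalSet Γ → ℤ) :=
    { toFun φ I := coord I (Chain.single I) φ.1
      map_zero' := funext fun I => map_zero (coord I (Chain.single I))
      map_add' φ ψ := funext fun I => map_add (coord I (Chain.single I)) φ.1 ψ.1 }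
  let L : LinearMap.ker (K.d 0 1).hom →ₗ[ℤ] (SphericalSet Γ → ℤ) :=
    { f with map_smul' m φ := map_intCast_smul f ℤ ℤ m φ }
  have hL : Function.Bijective L := by
    have h : ∀ φ : cells (W Γ) (SphericalCoset Γ) 0 ⟶ repRingFunctor (W Γ),
        φ ∈ LinearMap.ker (K.d 0 1).hom ↔ boundary _ _ 0 ≫ φ = 0 := fun φ => by
      rw [← cochainComplex_d_apply]; rfl
    exact bijective_coord_single.comp (Equiv.subtypeEquivRight h).bijective
  exact ⟨e.trans (LinearEquiv.ofBijective L hL)⟩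

end RACG

end
theorem mainTheorem5 {V : Type u} [Finite V] (Γ : SimpleGraph V) :
    (∀ n : ℕ, 0 < n → Subsingleton (RACG.davisCohomology Γ n)) ∧
    Module.Free ℤ (RACG.davisCohomology Γ 0) ∧
    Module.rank ℤ (RACG.davisCohomology Γ 0) = (Nat.card (RACG.sphericalSubgroups Γ) : Cardinal) := by
  obtain ⟨e⟩ := RACG.nonempty_davisCohomology_zero_equiv Γ
  have := Fintype.ofFinite (RACG.SphericalSet Γ)
  refine ⟨fun n hn => ?_, Module.Free.of_equiv e.symm, ?_⟩
  · obtain ⟨m, rfl⟩ := Nat.exists_eq_succ_of_ne_zero hn.ne'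
    exact RACG.subsingleton_davisCohomology_succ Γ m
  · rw [e.rank_eq, rank_fun', RACG.card_sphericalSubgroups, Nat.card_eq_fintype_card]
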